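/- **Conventions.** For a topological space $X$ put $x\le y$ iff the principal ultrafilter at $x$ converges to $y$ (the dual of the specialisation order). For continuous maps $f:X\to Y$ and $g:Y\to X$ write $f\dashv g$ if $x\le g(f(x))$ for all $x\in X$ and $f(g(y))\le y$ for all $y\in Y$; then $f$ is called a left adjoint and $g$ a right adjoint. Let $\mathbf 2=\{0,1\}$ be the Sierpiński space with $\{1\}$ closed and $\{0\}$ open. The dual space $X^{\mathrm{op}}$ is the set of ultrafilters on $X$ with the topology having as base the sets $A^\#=\{\mathfrak x\mid A\in\mathfrak x\}$, $A\subseteq X$ closed; it is exponentiable, and $PX=\mathbf 2^{X^{\mathrm{op}}}$ is the space of continuous maps $X^{\mathrm{op}}\to\mathbf 2$ with the compact-open topology. The Yoneda embedding is the continuous map $y_X:X\to PX$ with $y_X(x)(\mathfrak x)=1$ iff $\mathfrak x$ converges to $x$. The space $X$ is *cocomplete* if $y_X$ has a (continuous) left adjoint $\mathrm{Sup}_X:PX\to X$, and *completely distributive* if moreover $\mathrm{Sup}_X$ has a (continuous) left adjoint $t_X:X\to PX$. Let $\mathsf{CDTop}$ be the category of completely distributive T$_0$ spaces and continuous maps that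 are both left and right adjoints, and $\mathsf{Frm}$ the category of frames and frame homomorphisms. For a frame $L$ let $FL$ be the set of all filters of $L$ (including the improper one) with the topology having as base the sets $x^\#=\{\mathfrak f\mid x\in\mathfrak f\}$, $x\in L$; for a frame homomorphism $f:L\to M$ let $Ff:FL\to FM$ send $\mathfrak f$ to the up-closure of $\{f(x)\mid x\in\mathfrak f\}$. For a space $X$ in $\mathsf{CDTop}$ let $\Lambda(X)$ be the set of continuous left adjoints $X\to\mathbf 2$, ordered pointwise, and $\mathrm{Pt}(X)=\Lambda(X)^{\mathrm{op}}$; for $f:X\to Y$ in $\mathsf{CDTop}$ with left adjoint $g:Y\to X$ let $\mathrm{Pt}(f)$ send $\varphi$ to $\varphi\cdot g$. **Theorem.** The categories $\mathsf{Frm}$ and $\mathsf{CDTop}$ are equivalent. More precisely, there is an equivalence of categories $\mathsf{Frm}\simeq\mathsf{CDTop}$ whose functor $\mathsf{Frm}\to\mathsf{CDTop}$ is, as a functor into topological spaces, naturally isomorphic to $F$, and whose inverse $\mathsf{CDTop}\to\mathsf{Frm}$ is, as a functor into partially ordered sets, naturally isomorphic to $\mathrm{Pt}$. Moreover it preserves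 and reflects the order on hom-sets: for frame homomorphisms $f,g:L\to M$, one has $f\le g$ pointwise if and only if the image of $f$ is pointwise $\le$ the image of $g$ in the underlying order. -/

import Mathlib

open CategoryTheory TopologicalSpace Topology

universe u

namespace CDSpace

section Order2Cells

variable {X Y Z : Type*} [TopologicalSpace X] [TopologicalSpace Y] [TopologicalSpace Z]

/-- The underlying order of a space: `x ≤ y` iff the principal ultrafilter at `x` converges to `y`.
This is the dual of the specialisation order; no instance is declared for it. -/
def ptLE (x y : X) : Prop := (pure x : Filter X) ≤ 𝓝 y

theorem ptLE_iff_specializes {x y : X} : ptLE x y ↔ x ⤳ y := specializes_iff_pure.symm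

/-- `f ⊣ g` in the 2-category of topological spaces, whose hom-sets carry the pointwise order
induced by the underlying orders. -/
def Adj (f : C(X, Y)) (g : C(Y, X)) : Prop :=
  (∀ x, ptLE x (g (f x))) ∧ ∀ y, ptLE (f (g y)) y

/-- `f` is a left adjoint in topological spaces. -/
def IsLeftAdj (f : C(X, Y)) : Prop := ∃ g : C(Y, X), Adj f g

/-- `f` is a right adjoint in topological spaces. -/
def IsRightAdj (f : C(X, Y)) : Prop := ∃ g : C(Y, X), Adj g f

theorem ptLE_map (f : C(X, Y)) {x y : X} (h : ptLE x y) : ptLE (f x) (f y) :=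
  ptLE_iff_specializes.2 ((ptLE_iff_specializes.1 h).map f.continuous)

theorem ptLE_trans {x y z : X} (h : ptLE x y) (k : ptLE y z) : ptLE x z :=
  ptLE_iff_specializes.2 ((ptLE_iff_specializes.1 h).trans (ptLE_iff_specializes.1 k))

theorem ptLE_refl (x : X) : ptLE x x := pure_le_nhds x

theorem Adj.comp {f : C(X, Y)} {f' : C(Y, X)} {g : C(Y, Z)} {g' : C(Z, Y)}
    (hf : Adj f f') (hg : Adj g g') : Adj (g.comp f) (f'.comp g') :=
  ⟨fun x => ptLE_trans (hf.1 x) (ptLE_map f' (hg.1 (f x))),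
    fun z => ptLE_trans (ptLE_map g (hf.2 (g' z))) (hg.2 z)⟩

theorem adj_id : Adj (ContinuousMap.id X) (ContinuousMap.id X) :=
  ⟨fun x => ptLE_refl x, fun x => ptLE_refl x⟩

theorem Adj.left_unique [T0Space Y] {f g : C(X, Y)} {h : C(Y, X)} (hf : Adj f h) (hg : Adj g h) :
    f = g := by
  ext x
  refine ((ptLE_iff_specializes.1 ?_).antisymm (ptLE_iff_specializes.1 ?_)).eq
  · exact ptLE_trans (ptLE_map f (hg.1 x)) (hf.2 (g x))
  · exact ptLE_trans (ptLE_map g (hf.1 x)) (hg.2 (f x))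

end Order2Cells

/-- The Sierpinski space `2 = {0, 1}`, a point being given by a truth value (`0` is false, `1` is
true). -/
@[ext]
structure Two : Type where
  Holds : Prop

/-- In the Sierpinski space `{0}` is open and `{1}` is closed, so that continuous maps into it are
the characteristic maps of closed subsets. -/
instance : TopologicalSpace Two := generateFrom {{z : Two | ¬ z.Holds}}

theorem continuous_two_iff {X : Type*} [TopologicalSpace X] {φ : X → Two} :
    Continuous φ ↔ IsOpen {x | ¬ (φ x).Holds} := by
  rw [continuous_generateFrom_iff]
  simp

theorem isOpen_two {U : Set Two} (hU : IsOpen U) :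
    U = ∅ ∨ U = {z : Two | ¬ z.Holds} ∨ U = Set.univ := by
  induction hU with
  | basic U hU => exact .inr (.inl hU)
  | univ => exact .inr (.inr rfl)
  | inter U V _ _ hU hV =>
    rcases hU with rfl | rfl | rfl <;> rcases hV with rfl | rfl | rfl <;> simp
  | sUnion S _ ih =>
    by_cases h1 : Set.univ ∈ S
    · exact .inr (.inr (Set.eq_univ_of_univ_subset (Set.subset_sUnion_of_mem h1)))
    by_cases h2 : {z : Two | ¬ z.Holds} ∈ S
    · refine .inr (.inl (subset_antisymm (Set.sUnion_subset fun U hU => ?_)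
        (Set.subset_sUnion_of_mem h2)))
      rcases ih U hU with rfl | rfl | rfl
      · exact Set.empty_subset _
      · exact subset_rfl
      · exact absurd hU h1
    · refine .inl (Set.sUnion_eq_empty.2 fun U hU => ?_)
      rcases ih U hU with rfl | rfl | rfl
      · rfl
      · exact absurd hU h2
      · exact absurd hU h1

section Presheaf

variable (X : Type u) [TopologicalSpace X]

/-- The points of the dual space `X^op` of `X` are the ultrafilters on `X`. (A structure, because
`Ultrafilter X` itself carries the topology of the Stone-Cech compactification of the set `X`.) -/
@[ext]
structure DualSpace : Type u where
  ultra : Ultrafilter X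

variable {X} in
/-- The set `A^#` of all ultrafilters containing `A`. -/
def sharp (A : Set X) : Set (DualSpace X) := {𝔵 | A ∈ 𝔵.ultra}

/-- The topology of the dual space has the sets `A^#`, for `A ⊆ X` closed, as a base of open
sets. (These sets are closed under finite intersections.) -/
instance : TopologicalSpace (DualSpace X) :=
  generateFrom {S | ∃ A : Set X, IsClosed A ∧ S = sharp A}

/-- The presheaf space `PX = 2^(X^op)`: all continuous maps from the dual space to `2`, with the
compact-open topology. The basic open sets `A^#` of the dual space are compact, hence the dual
space is locally compact and this is the exponential in topological spaces. -/
abbrev Presheaf : Type u := C(DualSpace X, Two)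

variable {X} in
theorem isOpen_sharp {A : Set X} (hA : IsClosed A) : IsOpen (sharp A) :=
  isOpen_generateFrom_of_mem ⟨A, hA, rfl⟩

variable {X} in
theorem not_le_nhds_iff {𝔵 : Ultrafilter X} {x : X} :
    ¬ ((𝔵 : Filter X) ≤ 𝓝 x) ↔ ∃ A : Set X, IsClosed A ∧ x ∉ A ∧ A ∈ 𝔵 := by
  rw [le_nhds_iff]
  push Not
  constructor
  · rintro ⟨V, hx, hV, h⟩
    exact ⟨Vᶜ, hV.isClosed_compl, fun h' => h' hx, Ultrafilter.compl_mem_iff_notMem.2 h⟩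
  · rintro ⟨A, hA, hx, h⟩
    exact ⟨Aᶜ, hx, hA.isOpen_compl, Ultrafilter.compl_notMem_iff.2 h⟩

variable {X} in
/-- The presheaf `x^* = a(-, x)` represented by `x`: its value at `𝔵` is `1` iff `𝔵` converges
to `x`. -/
def represented (x : X) : Presheaf X where
  toFun 𝔵 := ⟨(𝔵.ultra : Filter X) ≤ 𝓝 x⟩
  continuous_toFun := by
    rw [continuous_two_iff, isOpen_iff_forall_mem_open]
    intro 𝔵 h
    obtain ⟨A, hA, hx, hm⟩ := not_le_nhds_iff.1 h
    exact ⟨sharp A, fun 𝔶 h𝔶 => not_le_nhds_iff.2 ⟨A, hA, hx, h𝔶⟩, isOpen_sharp hA, hm⟩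

/-- The Yoneda embedding `X → PX`, `x ↦ x^*`. -/
def yoneda : C(X, Presheaf X) where
  toFun := represented
  continuous_toFun := by
    rw [ContinuousMap.continuous_compactOpen]
    intro K hK U hU
    rcases isOpen_two hU with rfl | rfl | rfl
    · rcases K.eq_empty_or_nonempty with rfl | ⟨𝔵, h𝔵⟩
      · simp
      · convert isOpen_empty using 1
        exact Set.eq_empty_of_forall_notMem fun x h => h h𝔵
    · rw [isOpen_iff_forall_mem_open]
      intro x hx
      obtain ⟨t, ht⟩ := hK.elim_finite_subcover
        (fun A : {A : Set X // IsClosed A ∧ x ∉ A} => sharp A.1)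
        (fun A => isOpen_sharp A.2.1) (fun 𝔵 h𝔵 => by
          obtain ⟨A, hA, hxA, hm⟩ := not_le_nhds_iff.1 (hx h𝔵)
          exact Set.mem_iUnion.2 ⟨⟨A, hA, hxA⟩, hm⟩)
      refine ⟨⋂ A ∈ t, A.1ᶜ, fun y hy 𝔵 h𝔵 => ?_,
        isOpen_biInter_finset fun A _ => A.2.1.isOpen_compl,
        Set.mem_iInter₂.2 fun A _ => A.2.2⟩
      obtain ⟨A, hAt, hm⟩ := Set.mem_iUnion₂.1 (ht h𝔵)
      exact not_le_nhds_iff.2 ⟨A.1, A.2.1, Set.mem_iInter₂.1 hy A hAt, hm⟩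
    · simp

/-- `X` is cocomplete: the Yoneda embedding has a left adjoint `Sup`. -/
def Cocomplete : Prop := ∃ S : C(Presheaf X, X), Adj S (yoneda X)

/-- `X` is completely distributive: it is cocomplete and the left adjoint `Sup` of the Yoneda
embedding has itself a left adjoint `t`. -/
def CompletelyDistributive : Prop :=
  ∃ S : C(Presheaf X, X), Adj S (yoneda X) ∧ ∃ t : C(X, Presheaf X), Adj t S

end Presheaf

end CDSpace

open CDSpace

/-- Completely distributive T0 topological spaces. -/
structure CDTop where
  carrier : Type u
  [top : TopologicalSpace carrier]
  [t0 : T0Space carrier]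
  cd : CompletelyDistributive carrier

namespace CDTop

attribute [instance] CDTop.top CDTop.t0

/-- Morphisms: continuous maps which are both left adjoints and right adjoints. -/
@[ext]
structure Hom (X Y : CDTop.{u}) where
  map : C(X.carrier, Y.carrier)
  isLeftAdj : IsLeftAdj map
  isRightAdj : IsRightAdj map

instance : Category CDTop.{u} where
  Hom := Hom
  id X := ⟨ContinuousMap.id _, ⟨_, adj_id⟩, ⟨_, adj_id⟩⟩
  comp f g := ⟨g.map.comp f.map,
    let ⟨_, hf⟩ := f.isLeftAdj; let ⟨_, hg⟩ := g.isLeftAdj; ⟨_, hf.comp hg⟩,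
    let ⟨_, hf⟩ := f.isRightAdj; let ⟨_, hg⟩ := g.isRightAdj; ⟨_, hg.comp hf⟩⟩

/-- The continuous map underlying a morphism. -/
def contMap {X Y : CDTop.{u}} (f : X ⟶ Y) : C(X.carrier, Y.carrier) := Hom.map f

/-- The inclusion of completely distributive T0 spaces into all topological spaces. -/
def toTopCat : CDTop.{u} ⥤ TopCat.{u} where
  obj X := TopCat.of X.carrier
  map f := TopCat.ofHom (contMap f)

/-- The (unique) left adjoint of a morphism. -/
noncomputable def leftAdj {X Y : CDTop.{u}} (f : X ⟶ Y) : C(Y.carrier, X.carrier) :=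
  (Hom.isRightAdj f).choose

theorem adj_leftAdj {X Y : CDTop.{u}} (f : X ⟶ Y) : Adj (leftAdj f) (contMap f) :=
  (Hom.isRightAdj f).choose_spec

theorem leftAdj_id (X : CDTop.{u}) : leftAdj (𝟙 X) = ContinuousMap.id _ :=
  (adj_leftAdj (𝟙 X)).left_unique adj_id

theorem leftAdj_comp {X Y Z : CDTop.{u}} (f : X ⟶ Y) (g : Y ⟶ Z) :
    leftAdj (f ≫ g) = (leftAdj f).comp (leftAdj g) :=
  (adj_leftAdj (f ≫ g)).left_unique ((adj_leftAdj g).comp (adj_leftAdj f))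

end CDTop

namespace CDSpace

section Lambda

/-- `Λ(X)`: the continuous maps `X → 2` that are left adjoints. -/
def Lam (X : Type u) [TopologicalSpace X] : Type u := {φ : C(X, Two) // IsLeftAdj φ}

variable {X Y : Type u} [TopologicalSpace X] [TopologicalSpace Y]

/-- The value of `φ ∈ Λ(X)` at a point is `1`. -/
def Lam.Holds (φ : Lam X) (x : X) : Prop := (φ.1 x).Holds

/-- `Λ(X)` is ordered pointwise (with `0 ≤ 1` in `2`). -/
instance : PartialOrder (Lam X) where
  le φ ψ := ∀ x, φ.Holds x → ψ.Holds x
  le_refl _ _ h := h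
  le_trans _ _ _ h k x hx := k x (h x hx)
  le_antisymm _ _ h k := Subtype.ext (ContinuousMap.ext fun x => Two.ext (propext ⟨h x, k x⟩))

/-- Precomposition with a left adjoint `g : Y → X`. -/
def Lam.precomp (g : C(Y, X)) (hg : IsLeftAdj g) : Lam X →o Lam Y where
  toFun φ := ⟨φ.1.comp g, let ⟨_, h⟩ := hg; let ⟨_, k⟩ := φ.2; ⟨_, h.comp k⟩⟩
  monotone' _ _ h y hy := h (g y) hy

end Lambda

/-- `Pt : X ↦ Λ(X)ᵒᵖ`, regarded as a functor to partially ordered sets; a morphism `f : X → Y`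
with left adjoint `g : Y → X` is sent to `φ ↦ φ ∘ g`. -/
noncomputable def ptFunctor : CDTop.{u} ⥤ PartOrd.{u} where
  obj X := PartOrd.of (Lam X.carrier)ᵒᵈ
  map f := PartOrd.ofHom (OrderHom.dual
    (Lam.precomp (CDTop.leftAdj f) ⟨CDTop.contMap f, CDTop.adj_leftAdj f⟩))
  map_id X := by
    ext φ
    exact congrArg OrderDual.toDual (Subtype.ext (ContinuousMap.ext fun x =>
      congrArg (fun g : C(X.carrier, X.carrier) => (OrderDual.ofDual φ).1 (g x))
        (CDTop.leftAdj_id X)))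
  map_comp {X Y Z} f g := by
    ext φ
    exact congrArg OrderDual.toDual (Subtype.ext (ContinuousMap.ext fun z =>
      congrArg (fun h : C(Z.carrier, X.carrier) => (OrderDual.ofDual φ).1 (h z))
        (CDTop.leftAdj_comp f g)))

section FilterSpace

/-- The filter space `FL` of a frame `L`: all filters of `L`, including the improper one. -/
abbrev FilterSpace (L : Type u) [Order.Frame L] : Type u := Order.PFilter L

variable {L M N : Type u} [Order.Frame L] [Order.Frame M] [Order.Frame N]

/-- The topology of the filter space has as base of open sets the sets
`x^# = {𝔣 | x ∈ 𝔣}`, `x ∈ L`. -/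
instance : TopologicalSpace (FilterSpace L) :=
  generateFrom (Set.range fun x : L => {𝔣 : FilterSpace L | x ∈ 𝔣})

/-- The filter generated by the image of `𝔣` under a frame homomorphism `f`: the up-closure of
`{f x | x ∈ 𝔣}`. -/
def FilterSpace.mapFun (f : FrameHom L M) (𝔣 : FilterSpace L) : FilterSpace M :=
  Order.IsPFilter.toPFilter (F := {y | ∃ x ∈ 𝔣, f x ≤ y}) <| by
    refine Order.IsPFilter.of_def ?_ ?_ ?_
    · obtain ⟨x, hx⟩ := Order.PFilter.nonempty 𝔣
      exact ⟨f x, x, hx, le_rfl⟩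
    · rintro y ⟨x, hx, hxy⟩ y' ⟨x', hx', hxy'⟩
      obtain ⟨z, hz, hzx, hzx'⟩ := Order.PFilter.directed 𝔣 x hx x' hx'
      exact ⟨f z, ⟨z, hz, le_rfl⟩, (OrderHomClass.mono f hzx).trans hxy,
        (OrderHomClass.mono f hzx').trans hxy'⟩
    · rintro y y' h ⟨x, hx, hxy⟩
      exact ⟨x, hx, hxy.trans h⟩

theorem FilterSpace.mem_mapFun {f : FrameHom L M} {𝔣 : FilterSpace L} {y : M} :
    y ∈ (mapFun f 𝔣) ↔ ∃ x ∈ 𝔣, f x ≤ y := Iff.rfl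

/-- The continuous map `Ff : FL → FM`. -/
def FilterSpace.map (f : FrameHom L M) : C(FilterSpace L, FilterSpace M) where
  toFun := mapFun f
  continuous_toFun := by
    rw [continuous_generateFrom_iff]
    rintro _ ⟨y, rfl⟩
    have h : mapFun f ⁻¹' {𝔤 : FilterSpace M | y ∈ 𝔤} =
        ⋃ x : {x : L // f x ≤ y}, {𝔣 : FilterSpace L | x.1 ∈ 𝔣} := by
      ext 𝔣
      simp only [Set.mem_preimage, Set.mem_ofPred_eq, mem_mapFun, Set.mem_iUnion, Subtype.exists,
        exists_prop]
      exact ⟨fun ⟨x, a, b⟩ => ⟨x, b, a⟩, fun ⟨x, b, a⟩ => ⟨x, a, b⟩⟩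
    rw [h]
    exact isOpen_iUnion fun x => isOpen_generateFrom_of_mem ⟨x.1, rfl⟩

theorem FilterSpace.map_id_apply (𝔣 : FilterSpace L) : mapFun (FrameHom.id L) 𝔣 = 𝔣 := by
  apply Order.PFilter.ext
  ext y
  exact ⟨fun ⟨_, hx, h⟩ => Order.PFilter.mem_of_le h hx, fun h => ⟨y, h, le_rfl⟩⟩

theorem FilterSpace.map_comp_apply (f : FrameHom L M) (g : FrameHom M N) (𝔣 : FilterSpace L) :
    mapFun (g.comp f) 𝔣 = mapFun g (mapFun f 𝔣) := by
  apply Order.PFilter.ext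
  ext y
  refine ⟨fun ⟨x, hx, h⟩ => ⟨f x, ⟨x, hx, le_rfl⟩, h⟩, ?_⟩
  rintro ⟨z, ⟨x, hx, hxz⟩, h⟩
  exact ⟨x, hx, (OrderHomClass.mono g hxz).trans h⟩

end FilterSpace

/-- The filter space functor `F`, regarded as a functor from frames to topological spaces. -/
def filterFunctor : Frm.{u} ⥤ TopCat.{u} where
  obj L := TopCat.of (FilterSpace L)
  map f := TopCat.ofHom (FilterSpace.map f.hom)
  map_id L := by
    refine TopCat.hom_ext (ContinuousMap.ext fun 𝔣 => ?_)
    exact FilterSpace.map_id_apply 𝔣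
  map_comp f g := by
    refine TopCat.hom_ext (ContinuousMap.ext fun 𝔣 => ?_)
    exact FilterSpace.map_comp_apply f.hom g.hom 𝔣

end CDSpace

/-! The presheaf space `PX` is the filter space of the frame of open sets of `X`: a presheaf
corresponds to the filter of those open `U` such that it vanishes at every ultrafilter containing
the complement of `U`. The Yoneda embedding becomes the map sending a point to its filter of open
neighbourhoods (`presheafHomeomorph`). Complete distributivity therefore says that `openNhds X` has
a left adjoint `S`, which has a left adjoint `t` (`completelyDistributive_iff`). The underlying
order of `FL` is reverse inclusion of filters.

For a frame `L`, the map `x ↦ x^#` from `L` to the open sets of `FL` has a left adjoint `openSup`,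
which preserves binary meets by the frame law. Inverse images of filters along these two maps give
`S` and `t` for `FL`. A frame homomorphism `f` induces a map `Ff` with left adjoint the inverse
image along `f` and with a right adjoint built from the right adjoint of `f`, so `F` lands in
`CDTop`.

`F` is essentially surjective because `U ↦ {x | U ∈ t x}` is a nucleus on the open sets of a
completely distributive `X`. Its fixed points are open principal down-sets, and `X` is the filter
space of this frame (`homeomorphFilterSpace`). `F` is full because the left adjoints `FL → 2` are
exactly the characteristic maps of complements of the sets `x^#` (`Lam.exists_ofElement_eq`):
composing them with the left adjoint of a morphism yields a map of frames
(`FilterSpace.exists_map_eq`). Faithfulness and the comparison of orders are read off at principal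
filters. The same description of `Λ(FL)` identifies `L` with `Pt(FL)`. -/

namespace CDSpace

/-! ### Order and adjunctions between spaces. -/

section Order2Cells

variable {X Y Z : Type*} [TopologicalSpace X] [TopologicalSpace Y] [TopologicalSpace Z]

theorem ptLE_iff_forall_open {x y : X} : ptLE x y ↔ ∀ U : Set X, IsOpen U → y ∈ U → x ∈ U :=
  ptLE_iff_specializes.trans specializes_iff_forall_open

theorem ptLE.mem_open {x y : X} (h : ptLE x y) {U : Set X} (hU : IsOpen U) (hy : y ∈ U) :
    x ∈ U :=
  ptLE_iff_forall_open.1 h U hU hy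

theorem ptLE_antisymm [T0Space X] {x y : X} (h : ptLE x y) (k : ptLE y x) : x = y :=
  ((ptLE_iff_specializes.1 h).antisymm (ptLE_iff_specializes.1 k)).eq

theorem adj_iff {f : C(X, Y)} {g : C(Y, X)} :
    Adj f g ↔ ∀ x y, ptLE (f x) y ↔ ptLE x (g y) :=
  ⟨fun h _ _ => ⟨fun k => ptLE_trans (h.1 _) (ptLE_map g k),
    fun k => ptLE_trans (ptLE_map f k) (h.2 _)⟩,
   fun h => ⟨fun _ => (h _ _).1 (ptLE_refl _), fun _ => (h _ _).2 (ptLE_refl _)⟩⟩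

theorem Adj.ptLE_iff {f : C(X, Y)} {g : C(Y, X)} (h : Adj f g) {x : X} {y : Y} :
    ptLE (f x) y ↔ ptLE x (g y) :=
  adj_iff.1 h x y

theorem Adj.right_unique [T0Space X] {f : C(X, Y)} {g h : C(Y, X)} (hg : Adj f g)
    (hh : Adj f h) : g = h := by
  ext y
  exact ptLE_antisymm (hh.ptLE_iff.1 (hg.2 y)) (hg.ptLE_iff.1 (hh.2 y))

theorem adj_homeomorph (e : X ≃ₜ Y) : Adj (e : C(X, Y)) (e.symm : C(Y, X)) :=
  ⟨fun _ => by simpa using ptLE_refl _, fun _ => by simpa using ptLE_refl _⟩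

end Order2Cells

/-! ### Filter spaces and the adjoints of the maps induced by frame homomorphisms. -/

section FilterSpace

variable {L M : Type u} [Order.Frame L] [Order.Frame M]

/-- Construct a filter of a frame from its closure properties. -/
def FilterSpace.mk (s : Set L) (top : ⊤ ∈ s) (inf : ∀ x ∈ s, ∀ y ∈ s, x ⊓ y ∈ s)
    (up : ∀ x y, x ≤ y → x ∈ s → y ∈ s) : FilterSpace L :=
  Order.IsPFilter.toPFilter (F := s) <| .of_def ⟨⊤, top⟩
    (fun x hx y hy => ⟨x ⊓ y, inf x hx y hy, inf_le_left, inf_le_right⟩) (up _ _)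

@[simp]
theorem FilterSpace.mem_mk {s : Set L} {top inf up} {x : L} :
    x ∈ FilterSpace.mk s top inf up ↔ x ∈ s :=
  Iff.rfl

/-- The basic open set `x^#` of the filter space. -/
def FilterSpace.basic (x : L) : Opens (FilterSpace L) :=
  ⟨{𝔣 | x ∈ 𝔣}, isOpen_generateFrom_of_mem ⟨x, rfl⟩⟩

@[simp]
theorem FilterSpace.mem_basic {x : L} {𝔣 : FilterSpace L} : 𝔣 ∈ basic x ↔ x ∈ 𝔣 := Iff.rfl

theorem FilterSpace.basic_mono {x y : L} (h : x ≤ y) : basic x ≤ basic y :=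
  fun _ hx => Order.PFilter.mem_of_le h hx

theorem FilterSpace.basic_inf (x y : L) : basic (x ⊓ y) = basic x ⊓ basic y := by
  ext 𝔣
  exact Order.PFilter.inf_mem_iff

theorem FilterSpace.basic_top : basic (⊤ : L) = ⊤ := by
  ext 𝔣
  simp

theorem FilterSpace.isTopologicalBasis :
    IsTopologicalBasis (Set.range fun x : L => {𝔣 : FilterSpace L | x ∈ 𝔣}) where
  exists_subset_inter := by
    rintro _ ⟨x, rfl⟩ _ ⟨y, rfl⟩ 𝔣 h
    exact ⟨_, ⟨x ⊓ y, rfl⟩, Order.PFilter.inf_mem_iff.2 h, fun 𝔤 => Order.PFilter.inf_mem_iff.1⟩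
  sUnion_eq := Set.eq_univ_of_forall fun 𝔣 => ⟨_, ⟨⊤, rfl⟩, Order.PFilter.top_mem⟩
  eq_generateFrom := rfl

theorem FilterSpace.exists_basic_le {U : Set (FilterSpace L)} (hU : IsOpen U) {𝔣 : FilterSpace L}
    (h : 𝔣 ∈ U) : ∃ x ∈ 𝔣, ∀ 𝔤 : FilterSpace L, x ∈ 𝔤 → 𝔤 ∈ U := by
  obtain ⟨_, ⟨x, rfl⟩, hx, hxU⟩ := isTopologicalBasis.exists_subset_of_mem_open h hU
  exact ⟨x, hx, fun 𝔤 h𝔤 => hxU h𝔤⟩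

theorem FilterSpace.continuous_iff {X : Type*} [TopologicalSpace X] {f : X → FilterSpace L} :
    Continuous f ↔ ∀ x : L, IsOpen {p | x ∈ f p} := by
  rw [continuous_generateFrom_iff, Set.forall_mem_range]
  rfl

/-- Larger filters lie in more basic open sets, so the underlying order reverses inclusion; in
return `x ↦ .principal x` becomes monotone. -/
theorem FilterSpace.ptLE_iff {𝔣 𝔤 : FilterSpace L} : ptLE 𝔣 𝔤 ↔ 𝔤 ≤ 𝔣 := by
  rw [ptLE_iff_forall_open]
  refine ⟨fun h x hx => h _ (basic x).isOpen hx, fun h U hU h𝔤 => ?_⟩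
  obtain ⟨x, hx, hxU⟩ := exists_basic_le hU h𝔤
  exact hxU _ (h hx)

instance : T0Space (FilterSpace L) :=
  ⟨fun _ _ h => le_antisymm
    (FilterSpace.ptLE_iff.1 (ptLE_iff_specializes.2 h.specializes'))
    (FilterSpace.ptLE_iff.1 (ptLE_iff_specializes.2 h.specializes))⟩

/-- The inverse image of filters along a frame homomorphism, left adjoint to the map of filter
spaces. -/
def FilterSpace.comap (f : FrameHom L M) : C(FilterSpace M, FilterSpace L) where
  toFun 𝔤 := .mk {x | f x ∈ 𝔤} (by simp) (fun x hx y hy => by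
    simpa using ⟨hx, hy⟩) (fun _ _ h hx => Order.PFilter.mem_of_le (OrderHomClass.mono f h) hx)
  continuous_toFun := continuous_iff.2 fun x => (basic (f x)).isOpen

theorem FilterSpace.map_principal (f : FrameHom L M) (x : L) :
    map f (.principal x) = .principal (f x) := by
  apply Order.PFilter.ext
  ext y
  exact ⟨fun ⟨z, hz, h⟩ => le_trans (OrderHomClass.mono f hz) h, fun h => ⟨x, le_rfl, h⟩⟩

theorem FilterSpace.adj_comap_map (f : FrameHom L M) : Adj (comap f) (map f) := by
  refine adj_iff.2 fun 𝔤 𝔣 => ?_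
  rw [ptLE_iff, ptLE_iff]
  exact ⟨fun h y ⟨x, hx, hxy⟩ => Order.PFilter.mem_of_le hxy (h hx),
    fun h x hx => h ⟨x, hx, le_rfl⟩⟩

/-- The filter generated by the image of a filter under the right adjoint of a frame
homomorphism. -/
def FilterSpace.mapRight (f : FrameHom L M) : C(FilterSpace M, FilterSpace L) where
  -- The condition on `z` says that the right adjoint of `f` at `y` is at most `x`.
  toFun 𝔤 := .mk {x | ∃ y ∈ 𝔤, ∀ z, f z ≤ y → z ≤ x} ⟨⊤, by simp⟩
    (fun x ⟨y, hy, h⟩ x' ⟨y', hy', h'⟩ => ⟨y ⊓ y', Order.PFilter.inf_mem hy hy',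
      fun z hz => le_inf (h z (hz.trans inf_le_left)) (h' z (hz.trans inf_le_right))⟩)
    (fun x x' hx ⟨y, hy, h⟩ => ⟨y, hy, fun z hz => (h z hz).trans hx⟩)
  continuous_toFun := continuous_iff.2 fun x => by
    rw [isOpen_iff_forall_mem_open]
    rintro 𝔤 ⟨y, hy, h⟩
    exact ⟨basic y, fun 𝔥 h𝔥 => ⟨y, h𝔥, h⟩, (basic y).isOpen, hy⟩

theorem FilterSpace.adj_map_mapRight (f : FrameHom L M) : Adj (map f) (mapRight f) := by
  refine adj_iff.2 fun 𝔣 𝔤 => ?_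
  rw [ptLE_iff, ptLE_iff]
  constructor
  · rintro h x ⟨y, hy, hyx⟩
    obtain ⟨z, hz, hzy⟩ := h hy
    exact Order.PFilter.mem_of_le (hyx z hzy) hz
  · intro h y hy
    -- The witness is the right adjoint of `f` at `y`; that `f` maps it below `y` is where
    -- preservation of joins enters.
    refine ⟨sSup {z | f z ≤ y}, h ⟨y, hy, fun z hz => le_sSup hz⟩, ?_⟩
    rw [map_sSup, sSup_le_iff]
    rintro _ ⟨z, hz, rfl⟩
    exact hz

/-- Principal filters suffice to test the order, since `.principal x` is mapped to `.principal (f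
x)`. -/
theorem FilterSpace.map_le_map_iff (f g : FrameHom L M) :
    (∀ x, f x ≤ g x) ↔ ∀ 𝔣 : FilterSpace L, ptLE (map f 𝔣) (map g 𝔣) := by
  constructor
  · intro h 𝔣
    exact ptLE_iff.2 fun y ⟨x, hx, hxy⟩ => ⟨x, hx, (h x).trans hxy⟩
  · intro h x
    have := h (.principal x)
    rwa [ptLE_iff, map_principal, map_principal, Order.PFilter.principal_le_principal_iff] at this

end FilterSpace

/-! ### Presheaves as filters of open sets. -/

section PresheafFilter

variable {X : Type u} [TopologicalSpace X]

theorem dualSpace_isTopologicalBasis :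
    IsTopologicalBasis {S : Set (DualSpace X) | ∃ A : Set X, IsClosed A ∧ S = sharp A} where
  exists_subset_inter := by
    rintro _ ⟨A, hA, rfl⟩ _ ⟨B, hB, rfl⟩ 𝔵 h
    exact ⟨_, ⟨A ∩ B, hA.inter hB, rfl⟩, Filter.inter_mem h.1 h.2,
      fun 𝔶 h𝔶 => Filter.inter_mem_iff.1 h𝔶⟩
  sUnion_eq := Set.eq_univ_of_forall fun 𝔵 => ⟨_, ⟨_, isClosed_univ, rfl⟩, Filter.univ_mem⟩
  eq_generateFrom := rfl

/-- The dual space carries a coarser topology than the Stone-Cech compactification of the discrete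
set `X`, in which the same set is closed and hence compact. -/
theorem isCompact_sharp (A : Set X) : IsCompact (sharp A) := by
  have hc : Continuous (DualSpace.mk : Ultrafilter X → DualSpace X) := by
    rw [continuous_generateFrom_iff]
    rintro _ ⟨B, -, rfl⟩
    exact ultrafilter_isOpen_basic B
  convert (ultrafilter_isClosed_basic A).isCompact.image hc
  ext 𝔵
  exact ⟨fun h => ⟨𝔵.ultra, h, rfl⟩, by rintro ⟨_, h, rfl⟩; exact h⟩

/-- A filter of open sets each of which meets a set `A` is contained in an ultrafilter
containing `A`. -/
theorem exists_ultrafilter_of_opens (𝔣 : FilterSpace (Opens X)) (A : Set X)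
    (h : ∀ U ∈ 𝔣, ((U : Set X) ∩ A).Nonempty) :
    ∃ 𝔵 : Ultrafilter X, A ∈ 𝔵 ∧ ∀ U ∈ 𝔣, (U : Set X) ∈ 𝔵 := by
  have : Nonempty {U // U ∈ 𝔣} := ⟨⟨⊤, Order.PFilter.top_mem⟩⟩
  have hne : (⨅ U : {U // U ∈ 𝔣}, Filter.principal ((U.1 : Set X) ∩ A)).NeBot := by
    refine Filter.iInf_neBot_of_directed' ?_ fun U => Filter.principal_neBot_iff.2 (h U.1 U.2)
    rintro ⟨U, hU⟩ ⟨V, hV⟩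
    refine ⟨⟨U ⊓ V, Order.PFilter.inf_mem hU hV⟩, ?_, ?_⟩
    · exact Filter.principal_mono.2 fun x hx => ⟨hx.1.1, hx.2⟩
    · exact Filter.principal_mono.2 fun x hx => ⟨hx.1.2, hx.2⟩
  have key : ∀ U ∈ 𝔣, (U : Set X) ∩ A ∈ Ultrafilter.of
      (⨅ U : {U // U ∈ 𝔣}, Filter.principal ((U.1 : Set X) ∩ A)) := fun U hU =>
    Ultrafilter.of_le _ (Filter.mem_iInf_of_mem ⟨U, hU⟩ (Filter.mem_principal_self _))
  exact ⟨Ultrafilter.of _, Filter.mem_of_superset (key ⊤ Order.PFilter.top_mem)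
    Set.inter_subset_right, fun U hU => Filter.mem_of_superset (key U hU) Set.inter_subset_left⟩

/-- The filter of open sets corresponding to a presheaf. -/
def Presheaf.toFilter (φ : Presheaf X) : FilterSpace (Opens X) :=
  .mk {U | ∀ 𝔵 ∈ sharp (U : Set X)ᶜ, ¬ (φ 𝔵).Holds}
    (fun 𝔵 h => by simp [sharp] at h)
    (fun U hU V hV 𝔵 h => by
      have h' : (U : Set X)ᶜ ∪ (V : Set X)ᶜ ∈ 𝔵.ultra := by
        rw [← Set.compl_inter]
        exact h
      exact (Ultrafilter.union_mem_iff.1 h').elim (hU 𝔵) (hV 𝔵))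
    (fun U V hUV hU 𝔵 h => hU 𝔵 (Filter.mem_of_superset h (Set.compl_subset_compl.2 hUV)))

theorem Presheaf.mem_toFilter {φ : Presheaf X} {U : Opens X} :
    U ∈ φ.toFilter ↔ ∀ 𝔵 ∈ sharp (U : Set X)ᶜ, ¬ (φ 𝔵).Holds :=
  Iff.rfl

/-- The presheaf corresponding to a filter of open sets. -/
def Presheaf.ofFilter (𝔣 : FilterSpace (Opens X)) : Presheaf X where
  toFun 𝔵 := ⟨∀ U ∈ 𝔣, (U : Set X) ∈ 𝔵.ultra⟩
  continuous_toFun := by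
    rw [continuous_two_iff, isOpen_iff_forall_mem_open]
    intro 𝔵 h
    simp only [Set.mem_ofPred_eq, not_forall] at h
    obtain ⟨U, hU, h⟩ := h
    exact ⟨sharp (U : Set X)ᶜ, fun 𝔶 h𝔶 h' => Ultrafilter.compl_mem_iff_notMem.1 h𝔶 (h' U hU),
      isOpen_sharp U.isOpen.isClosed_compl, Ultrafilter.compl_mem_iff_notMem.2 h⟩

theorem Presheaf.ofFilter_holds {𝔣 : FilterSpace (Opens X)} {𝔵 : DualSpace X} :
    (ofFilter 𝔣 𝔵).Holds ↔ ∀ U ∈ 𝔣, (U : Set X) ∈ 𝔵.ultra :=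
  Iff.rfl

theorem Presheaf.ofFilter_toFilter (φ : Presheaf X) : ofFilter φ.toFilter = φ := by
  ext 𝔵
  rw [ofFilter_holds]
  constructor
  · intro h
    by_contra hφ
    -- The zero set of `φ` is open, so a basic set `A^#` around `𝔵` lies inside it; the open set
    -- `Aᶜ` then belongs to the filter but not to `𝔵`.
    obtain ⟨_, ⟨A, hA, rfl⟩, h𝔵, hsub⟩ := dualSpace_isTopologicalBasis.exists_subset_of_mem_open
      hφ (continuous_two_iff.1 φ.continuous)
    have hmem : (⟨Aᶜ, hA.isOpen_compl⟩ : Opens X) ∈ φ.toFilter := by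
      rw [mem_toFilter]
      intro 𝔶 h𝔶
      exact hsub (by simpa using h𝔶)
    exact Ultrafilter.compl_mem_iff_notMem.1 (h _ hmem) h𝔵
  · intro hφ U hU
    by_contra h
    exact hU 𝔵 (Ultrafilter.compl_mem_iff_notMem.2 h) hφ

theorem Presheaf.toFilter_ofFilter (𝔣 : FilterSpace (Opens X)) : (ofFilter 𝔣).toFilter = 𝔣 := by
  apply Order.PFilter.ext
  ext U
  simp only [SetLike.mem_coe, mem_toFilter, ofFilter_holds]
  constructor
  · intro h
    by_contra hU
    -- If `U ∉ 𝔣`, no member of `𝔣` lies inside `U`, so some ultrafilter contains both `𝔣` and the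
    -- complement of `U`.
    obtain ⟨𝔵, h1, h2⟩ := exists_ultrafilter_of_opens 𝔣 (U : Set X)ᶜ fun V hV => by
      by_contra hne
      rw [Set.inter_compl_nonempty_iff, not_not] at hne
      exact hU (Order.PFilter.mem_of_le hne hV)
    exact h ⟨𝔵⟩ h1 h2
  · intro hU 𝔵 h𝔵 h
    exact Ultrafilter.compl_mem_iff_notMem.1 h𝔵 (h U hU)

theorem Presheaf.continuous_toFilter :
    Continuous (toFilter : Presheaf X → FilterSpace (Opens X)) := by
  refine FilterSpace.continuous_iff.2 fun U => ?_
  have h : IsOpen {z : Two | ¬ z.Holds} := isOpen_generateFrom_of_mem rfl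
  exact ContinuousMap.isOpen_setOfPred_mapsTo (isCompact_sharp (U : Set X)ᶜ) h

theorem Presheaf.continuous_ofFilter :
    Continuous (ofFilter : FilterSpace (Opens X) → Presheaf X) := by
  rw [ContinuousMap.continuous_compactOpen]
  intro K hK V hV
  rcases isOpen_two hV with rfl | rfl | rfl
  · rcases K.eq_empty_or_nonempty with rfl | ⟨𝔵, h𝔵⟩
    · simp
    · convert isOpen_empty using 1
      exact Set.eq_empty_of_forall_notMem fun x h => h h𝔵
  · rw [isOpen_iff_forall_mem_open]
    intro 𝔣 h
    have : Nonempty {U // U ∈ 𝔣} := ⟨⟨⊤, Order.PFilter.top_mem⟩⟩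
    -- The cover is directed because `𝔣` is closed under meets; compactness thus leaves a single `U
    -- ∈ 𝔣`, and its basic open set is the required neighbourhood of `𝔣`.
    obtain ⟨⟨U, hU⟩, hKU⟩ := hK.elim_directed_cover
      (fun U : {U // U ∈ 𝔣} => sharp (U.1 : Set X)ᶜ)
      (fun U => isOpen_sharp U.1.isOpen.isClosed_compl)
      (fun 𝔵 h𝔵 => by
        have := h h𝔵
        simp only [Set.mem_ofPred_eq, ofFilter_holds, not_forall] at this
        obtain ⟨U, hU, hn⟩ := this
        exact Set.mem_iUnion.2 ⟨⟨U, hU⟩, Ultrafilter.compl_mem_iff_notMem.2 hn⟩)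
      (by
        rintro ⟨U, hU⟩ ⟨V, hV⟩
        refine ⟨⟨U ⊓ V, Order.PFilter.inf_mem hU hV⟩, fun 𝔵 h => ?_, fun 𝔵 h => ?_⟩
        · exact Filter.mem_of_superset h (Set.compl_subset_compl.2 fun _ h => h.1)
        · exact Filter.mem_of_superset h (Set.compl_subset_compl.2 fun _ h => h.2))
    refine ⟨FilterSpace.basic U, fun 𝔤 h𝔤 𝔵 h𝔵 h' => ?_, (FilterSpace.basic U).isOpen, hU⟩
    exact Ultrafilter.compl_mem_iff_notMem.1 (hKU h𝔵) (h' U h𝔤)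
  · simp

variable (X) in
/-- The presheaf space is the space of filters of open sets. -/
def presheafHomeomorph : Presheaf X ≃ₜ FilterSpace (Opens X) where
  toFun := Presheaf.toFilter
  invFun := Presheaf.ofFilter
  left_inv := Presheaf.ofFilter_toFilter
  right_inv := Presheaf.toFilter_ofFilter
  continuous_toFun := Presheaf.continuous_toFilter
  continuous_invFun := Presheaf.continuous_ofFilter

variable (X) in
/-- The filter of open neighbourhoods of a point. -/
def openNhds : C(X, FilterSpace (Opens X)) where
  toFun x := .mk {U | x ∈ U} trivial (fun _ hU _ hV => ⟨hU, hV⟩) (fun _ _ h hU => h hU)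
  continuous_toFun := FilterSpace.continuous_iff.2 fun U => U.isOpen

theorem ptLE_openNhds_iff {x y : X} : ptLE (openNhds X x) (openNhds X y) ↔ ptLE x y := by
  refine ⟨fun h => ptLE_iff_forall_open.2 fun U hU hy => ?_, ptLE_map _⟩
  exact FilterSpace.ptLE_iff.1 h (show (⟨U, hU⟩ : Opens X) ∈ openNhds X y from hy)

/-- An ultrafilter converges to `x` exactly when it contains every open neighbourhood of `x`. -/
theorem presheafHomeomorph_symm_comp_openNhds :
    ((presheafHomeomorph X).symm : C(_, _)).comp (openNhds X) = yoneda X := by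
  ext x 𝔵
  change (∀ U ∈ openNhds X x, (U : Set X) ∈ 𝔵.ultra) ↔ (𝔵.ultra : Filter X) ≤ 𝓝 x
  rw [le_nhds_iff]
  exact ⟨fun h s hx hs => h ⟨s, hs⟩ hx, fun h U hU => h U hU U.isOpen⟩

theorem presheafHomeomorph_comp_yoneda :
    (presheafHomeomorph X : C(_, _)).comp (yoneda X) = openNhds X := by
  rw [← presheafHomeomorph_symm_comp_openNhds]
  ext1 x
  simp

theorem completelyDistributive_iff : CompletelyDistributive X ↔
    ∃ S : C(FilterSpace (Opens X), X), Adj S (openNhds X) ∧ ∃ t, Adj t S := by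
  have h1 := adj_homeomorph (presheafHomeomorph X)
  have h2 := adj_homeomorph (presheafHomeomorph X).symm
  constructor
  · rintro ⟨S, hS, t, ht⟩
    refine ⟨S.comp (presheafHomeomorph X).symm, ?_, _, ht.comp h1⟩
    rw [← presheafHomeomorph_comp_yoneda]
    exact h2.comp hS
  · rintro ⟨S, hS, t, ht⟩
    refine ⟨S.comp (presheafHomeomorph X), ?_, _, ht.comp h2⟩
    rw [← presheafHomeomorph_symm_comp_openNhds]
    exact h1.comp hS

end PresheafFilter

/-! ### Complete distributivity and points of filter spaces. -/

theorem ptLE_two_iff {a b : Two} : ptLE a b ↔ (a.Holds → b.Holds) := by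
  rw [ptLE_iff_forall_open]
  constructor
  · intro h ha
    by_contra hb
    exact h _ (isOpen_generateFrom_of_mem rfl) hb ha
  · intro h U hU hb
    rcases isOpen_two hU with rfl | rfl | rfl
    · exact hb
    · exact fun ha => hb (h ha)
    · trivial

section FilterSpaceDistributive

variable {L : Type u} [Order.Frame L]

variable (L) in
/-- The supremum map of the filter space. -/
def FilterSpace.sup : C(FilterSpace (Opens (FilterSpace L)), FilterSpace L) where
  toFun 𝔉 := .mk {x | basic x ∈ 𝔉} (by simp [basic_top])
    (fun x hx y hy => by
      rw [Set.mem_ofPred_eq, basic_inf]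
      exact Order.PFilter.inf_mem hx hy)
    (fun x y h hx => Order.PFilter.mem_of_le (basic_mono h) hx)
  continuous_toFun := continuous_iff.2 fun x => (basic (basic x)).isOpen

@[simp]
theorem FilterSpace.mem_sup {𝔉 : FilterSpace (Opens (FilterSpace L))} {x : L} :
    x ∈ sup L 𝔉 ↔ basic x ∈ 𝔉 :=
  Iff.rfl

theorem FilterSpace.adj_sup_openNhds : Adj (sup L) (openNhds (FilterSpace L)) := by
  refine adj_iff.2 fun 𝔉 𝔣 => ?_
  rw [ptLE_iff, ptLE_iff]
  constructor
  · intro h U hU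
    obtain ⟨x, hx, hxU⟩ := exists_basic_le U.isOpen hU
    exact Order.PFilter.mem_of_le (show basic x ≤ U from fun 𝔤 => hxU 𝔤) (h hx)
  · intro h x hx
    exact h (show basic x ∈ openNhds _ 𝔣 from hx)

/-- The join of all elements whose basic open set is contained in a given open set. -/
def FilterSpace.openSup (U : Opens (FilterSpace L)) : L := sSup {x | basic x ≤ U}

theorem FilterSpace.openSup_mono {U V : Opens (FilterSpace L)} (h : U ≤ V) :
    openSup U ≤ openSup V :=
  sSup_le_sSup fun _ hx => le_trans hx h

theorem FilterSpace.le_openSup {x : L} {U : Opens (FilterSpace L)} (h : basic x ≤ U) :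
    x ≤ openSup U :=
  le_sSup h

/-- This is the frame distributive law; it makes the inverse image of a filter under `openSup`
closed under meets. -/
theorem FilterSpace.openSup_inf (U V : Opens (FilterSpace L)) :
    openSup U ⊓ openSup V ≤ openSup (U ⊓ V) := by
  rw [openSup, openSup, sSup_inf_sSup]
  refine iSup₂_le fun p hp => le_openSup ?_
  rw [basic_inf]
  exact inf_le_inf hp.1 hp.2

theorem FilterSpace.le_basic_openSup (U : Opens (FilterSpace L)) : U ≤ basic (openSup U) := by
  intro 𝔣 h
  obtain ⟨x, hx, hxU⟩ := exists_basic_le U.isOpen h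
  exact Order.PFilter.mem_of_le (le_openSup fun 𝔤 => hxU 𝔤) hx

variable (L) in
/-- The left adjoint of the supremum map of the filter space. -/
def FilterSpace.wayBelow : C(FilterSpace L, FilterSpace (Opens (FilterSpace L))) where
  toFun 𝔣 := .mk {U | openSup U ∈ 𝔣}
    (Order.PFilter.mem_of_le (le_openSup le_top) Order.PFilter.top_mem)
    (fun U hU V hV => Order.PFilter.mem_of_le (openSup_inf U V) (Order.PFilter.inf_mem hU hV))
    (fun _ _ h hU => Order.PFilter.mem_of_le (openSup_mono h) hU)
  continuous_toFun := continuous_iff.2 fun U => (basic (openSup U)).isOpen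

theorem FilterSpace.adj_wayBelow_sup : Adj (wayBelow L) (sup L) := by
  refine adj_iff.2 fun 𝔣 𝔉 => ?_
  rw [ptLE_iff, ptLE_iff]
  constructor
  · intro h x hx
    have : openSup (basic x) ∈ 𝔣 := h hx
    refine Order.PFilter.mem_of_le (sSup_le fun y hy => ?_) this
    -- Testing the inclusion of `y^#` in `x^#` at the principal filter of `y` gives `x ≤ y` in
    -- reverse, that is, `y ≤ x`.
    exact hy (show Order.PFilter.principal y ∈ basic y from le_rfl)
  · intro h U hU
    exact h (mem_sup.2 (Order.PFilter.mem_of_le (le_basic_openSup U) hU))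

theorem FilterSpace.completelyDistributive : CompletelyDistributive (FilterSpace L) :=
  completelyDistributive_iff.2 ⟨_, adj_sup_openNhds, _, adj_wayBelow_sup⟩

/-- The element of `Λ(FL)` represented by an element of the frame. -/
def Lam.ofElement (x : L) : Lam (FilterSpace L) :=
  ⟨⟨fun 𝔣 => ⟨x ∉ 𝔣⟩, continuous_two_iff.2 (by
      simp only [not_not]
      exact (FilterSpace.basic x).isOpen)⟩,
    -- The right adjoint sends `0` to the principal filter of `x` and `1` to the least filter `{⊤}`.
    ⟨fun z => .mk {y | x ≤ y ∧ (z.Holds → y = ⊤)} ⟨le_top, fun _ => rfl⟩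
      (fun y hy y' hy' => ⟨le_inf hy.1 hy'.1, fun h => by simp [hy.2 h, hy'.2 h]⟩)
      (fun y y' h hy => ⟨hy.1.trans h, fun hz => top_le_iff.1 ((hy.2 hz).ge.trans h)⟩), by
      refine FilterSpace.continuous_iff.2 fun y => ?_
      simp only [FilterSpace.mem_mk, Set.mem_ofPred_eq]
      refine isOpen_const.and ?_
      by_cases hy : y = ⊤
      · simp [hy]
      · simp only [hy, imp_false]
        exact isOpen_generateFrom_of_mem rfl⟩, by
    refine adj_iff.2 fun 𝔣 z => ?_
    rw [ptLE_two_iff, FilterSpace.ptLE_iff]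
    constructor
    · rintro h y ⟨hxy, hz⟩
      by_cases hx : x ∈ 𝔣
      · exact Order.PFilter.mem_of_le hxy hx
      · obtain rfl : y = ⊤ := hz (h hx)
        exact Order.PFilter.top_mem
    · intro h hx
      by_contra hz
      exact hx (h ⟨le_rfl, fun hz' => absurd hz' hz⟩)⟩

theorem Lam.ofElement_holds {x : L} {𝔣 : FilterSpace L} : (ofElement x).Holds 𝔣 ↔ x ∉ 𝔣 :=
  Iff.rfl

theorem Lam.ext_holds {X : Type u} [TopologicalSpace X] {φ ψ : Lam X}
    (h : ∀ x, φ.Holds x ↔ ψ.Holds x) : φ = ψ :=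
  le_antisymm (fun x => (h x).1) (fun x => (h x).2)

/-- If `c` is right adjoint to `φ`, then `φ` vanishes exactly at the filters containing `c ⟨False⟩`.
Openness of this zero set gives some `x` in `c ⟨False⟩` whose basic open set lies inside it, and the
two sets then agree. -/
theorem Lam.exists_ofElement_eq (φ : Lam (FilterSpace L)) : ∃ x, ofElement x = φ := by
  obtain ⟨c, hc⟩ := φ.2
  have key : ∀ 𝔣 : FilterSpace L, ¬ φ.Holds 𝔣 ↔ c ⟨False⟩ ≤ 𝔣 := fun 𝔣 => by
    rw [← FilterSpace.ptLE_iff, ← hc.ptLE_iff, ptLE_two_iff]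
    rfl
  obtain ⟨x, hx, h⟩ := FilterSpace.exists_basic_le (continuous_two_iff.1 φ.1.continuous)
    ((key _).2 le_rfl)
  refine ⟨x, ext_holds fun 𝔣 => ?_⟩
  rw [ofElement_holds, not_iff_comm]
  exact ⟨fun h' => (key 𝔣).1 h' hx, h 𝔣⟩

theorem Lam.ofElement_le_iff {x y : L} : ofElement x ≤ ofElement y ↔ y ≤ x := by
  constructor
  · intro h
    by_contra hn
    exact h (.principal y) (fun h' => hn h') le_rfl
  · intro h 𝔣 hx hy
    exact hx (Order.PFilter.mem_of_le h hy)

variable (L) in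
/-- A frame is the opposite of the ordered set of points of its filter space. -/
noncomputable def Lam.orderIsoElement : L ≃o (Lam (FilterSpace L))ᵒᵈ :=
  RelIso.ofSurjective (OrderEmbedding.ofMapLEIff (fun x => OrderDual.toDual (ofElement x))
    fun _ _ => ofElement_le_iff) exists_ofElement_eq

end FilterSpaceDistributive

/-! ### Reconstructing a completely distributive space from a frame of open sets. -/

section Reconstruction

variable {X : Type u} [TopologicalSpace X] {S : C(FilterSpace (Opens X), X)}
  {t : C(X, FilterSpace (Opens X))}

theorem ptLE_sup_openNhds (hS : Adj S (openNhds X)) (x : X) : ptLE x (S (openNhds X x)) :=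
  ptLE_openNhds_iff.1 (hS.1 (openNhds X x))

/-- By adjunction, the points whose filter `t x` contains `U` form the principal down-set of `S
(.principal U)`. -/
theorem mem_wayBelow_iff (ht : Adj t S) {x : X} {U : Opens X} :
    U ∈ t x ↔ ptLE x (S (.principal U)) := by
  rw [← ht.ptLE_iff, FilterSpace.ptLE_iff, Order.PFilter.principal_le_iff]

/-- The nucleus on the frame of open sets of a completely distributive space: it sends an open
set to the set of all points below its supremum. -/
def supNucleus (hS : Adj S (openNhds X)) (ht : Adj t S) : Nucleus (Opens X) where
  toFun U := ⟨{x | U ∈ t x}, FilterSpace.continuous_iff.1 t.continuous U⟩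
  map_inf' U V := by
    ext x
    exact Order.PFilter.inf_mem_iff
  le_apply' U x hx := by
    have : ptLE (t x) (openNhds X x) := ht.ptLE_iff.2 (ptLE_sup_openNhds hS x)
    exact FilterSpace.ptLE_iff.1 this hx
  idempotent' U x hx := by
    rw [← SetLike.mem_coe] at *
    refine (mem_wayBelow_iff ht).2 (ptLE_trans ((mem_wayBelow_iff ht).1 hx) ?_)
    -- Every open neighbourhood of `S (.principal U)` contains all points below it, hence the whole
    -- nucleus image of `U`; so passing to that image does not raise the supremum.
    rw [hS.ptLE_iff, FilterSpace.ptLE_iff]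
    intro V hV y hy
    exact ((mem_wayBelow_iff ht).1 hy).mem_open V.isOpen hV

theorem mem_supNucleus {hS : Adj S (openNhds X)} {ht : Adj t S} {U : Opens X} {x : X} :
    x ∈ supNucleus hS ht U ↔ U ∈ t x :=
  Iff.rfl

/-- The frame of open sets that are principal down-sets, for a completely distributive space. -/
abbrev SupFrame (hS : Adj S (openNhds X)) (ht : Adj t S) : Type u :=
  Set.range (supNucleus hS ht)

variable {hS : Adj S (openNhds X)} {ht : Adj t S}

theorem SupFrame.mem_iff (c : SupFrame hS ht) {x : X} : x ∈ c.1 ↔ c.1 ∈ t x := by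
  conv_lhs => rw [← Nucleus.mem_range.1 c.2]
  exact mem_supNucleus

theorem SupFrame.mem_iff_ptLE (c : SupFrame hS ht) {x : X} :
    x ∈ c.1 ↔ ptLE x (S (.principal c.1)) :=
  c.mem_iff.trans (mem_wayBelow_iff ht)

variable (hS ht) in
/-- The map sending a point to the filter of principal open down-sets containing it. -/
def toFilterSpace : C(X, FilterSpace (SupFrame hS ht)) where
  toFun x := .mk {c | x ∈ c.1} trivial (fun _ hc _ hd => ⟨hc, hd⟩) (fun _ _ h hc => h hc)
  continuous_toFun := FilterSpace.continuous_iff.2 fun c => c.1.isOpen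

theorem mem_toFilterSpace {x : X} {c : SupFrame hS ht} :
    c ∈ toFilterSpace hS ht x ↔ x ∈ c.1 :=
  Iff.rfl

/-- The filter of open sets generated by a filter of principal open down-sets. -/
def SupFrame.generate : C(FilterSpace (SupFrame hS ht), FilterSpace (Opens X)) where
  toFun 𝔣 := .mk {U | ∃ c ∈ 𝔣, c.1 ≤ U} ⟨⊤, by simp⟩
    (fun U ⟨c, hc, h⟩ V ⟨d, hd, h'⟩ => ⟨c ⊓ d, Order.PFilter.inf_mem hc hd,
      inf_le_inf h h'⟩)
    (fun _ _ hU ⟨c, hc, h⟩ => ⟨c, hc, h.trans hU⟩)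
  continuous_toFun := FilterSpace.continuous_iff.2 fun U => by
    rw [isOpen_iff_forall_mem_open]
    rintro 𝔣 ⟨c, hc, h⟩
    exact ⟨FilterSpace.basic c, fun 𝔤 h𝔤 => ⟨c, h𝔤, h⟩, (FilterSpace.basic c).isOpen, hc⟩

theorem sup_generate_toFilterSpace [T0Space X] (x : X) :
    S (SupFrame.generate (toFilterSpace hS ht x)) = x := by
  apply ptLE_antisymm
  · rw [hS.ptLE_iff, FilterSpace.ptLE_iff]
    intro W hW
    have hx : S (t x) ∈ W := (hS.ptLE_iff.2 (ht.ptLE_iff.2 (ptLE_sup_openNhds hS x))).mem_open W.isOpen hW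
    -- Continuity of `S` at `t x` gives `U ∈ t x` with `S (.principal U) ∈ W`. The nucleus image of
    -- `U` contains `x` and lies below that point, hence inside `W`.
    obtain ⟨U, hU, hUW⟩ := FilterSpace.exists_basic_le (W.isOpen.preimage S.continuous) hx
    refine ⟨⟨supNucleus hS ht U, U, rfl⟩, hU, fun y hy => ?_⟩
    exact ((mem_wayBelow_iff ht).1 hy).mem_open W.isOpen (hUW (.principal U) (Order.PFilter.mem_principal.2 le_rfl))
  · rw [← ht.ptLE_iff, FilterSpace.ptLE_iff]
    rintro U ⟨c, hc, h⟩
    exact Order.PFilter.mem_of_le h (c.mem_iff.1 hc)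

theorem toFilterSpace_sup_generate (𝔣 : FilterSpace (SupFrame hS ht)) :
    toFilterSpace hS ht (S (SupFrame.generate 𝔣)) = 𝔣 := by
  apply Order.PFilter.ext
  ext d
  rw [SetLike.mem_coe, mem_toFilterSpace, d.mem_iff_ptLE, hS.ptLE_iff, FilterSpace.ptLE_iff]
  constructor
  · intro h
    -- A fixed open set `d` contains its own supremum `S (.principal d.1)`, so it is a neighbourhood
    -- to which `h` applies.
    obtain ⟨c, hc, hcd⟩ := h (show d.1 ∈ openNhds X _ from d.mem_iff_ptLE.2 (ptLE_refl _))
    exact Order.PFilter.mem_of_le hcd hc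
  · intro hd U hU
    exact ⟨d, hd, fun y hy => (d.mem_iff_ptLE.1 hy).mem_open U.isOpen hU⟩

variable (hS ht) in
/-- A completely distributive T0 space is the filter space of a frame. -/
def homeomorphFilterSpace [T0Space X] : X ≃ₜ FilterSpace (SupFrame hS ht) where
  toFun := toFilterSpace hS ht
  invFun 𝔣 := S (SupFrame.generate 𝔣)
  left_inv := sup_generate_toFilterSpace
  right_inv := toFilterSpace_sup_generate
  continuous_toFun := (toFilterSpace hS ht).continuous
  continuous_invFun := S.continuous.comp SupFrame.generate.continuous

end Reconstruction
-- Maps of filter spaces that are both left and right adjoints.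
section Full

variable {L M : Type u} [Order.Frame L] [Order.Frame M]

/-- Every continuous map of filter spaces that is both a left and a right adjoint is induced by a
frame homomorphism. -/
theorem FilterSpace.exists_map_eq (h : C(FilterSpace L, FilterSpace M)) (hl : IsLeftAdj h)
    (hr : IsRightAdj h) : ∃ f : FrameHom L M, map f = h := by
  obtain ⟨k, hk⟩ := hl
  obtain ⟨g, hg⟩ := hr
  have key : ∀ x : L, ∃ y : M, ∀ 𝔤 : FilterSpace M, x ∈ g 𝔤 ↔ y ∈ 𝔤 := fun x => by
    -- Composing the point represented by `x` with the left adjoint `g` gives a point of `FM`,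
    -- represented by a unique `y`; this `y` will be `f x`.
    obtain ⟨y, hy⟩ := Lam.exists_ofElement_eq (Lam.precomp g ⟨h, hg⟩ (Lam.ofElement x))
    refine ⟨y, fun 𝔤 => not_iff_not.1 ?_⟩
    rw [← Lam.ofElement_holds (𝔣 := 𝔤), hy]
    rfl
  choose f hf using key
  have ext_mem : ∀ {a b : M}, (∀ 𝔤 : FilterSpace M, a ∈ 𝔤 ↔ b ∈ 𝔤) → a = b := fun {a b} H =>
    le_antisymm ((H (.principal a)).1 le_rfl) ((H (.principal b)).2 le_rfl)
  have h_principal : ∀ x : L, h (.principal x) = .principal (f x) := fun x => by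
    have : ∀ 𝔤, ptLE 𝔤 (h (.principal x)) ↔ ptLE 𝔤 (.principal (f x)) := fun 𝔤 => by
      rw [← hg.ptLE_iff, ptLE_iff, ptLE_iff, Order.PFilter.principal_le_iff,
        Order.PFilter.principal_le_iff, hf]
    exact ptLE_antisymm ((this _).1 (ptLE_refl _)) ((this _).2 (ptLE_refl _))
  -- The right adjoint `k` of `h` turns `f x ≤ y` into the condition that `x` is a lower bound of
  -- the filter `k (.principal y)`. Such conditions are compatible with joins in `x`, which is why
  -- `f` preserves them.
  have h_le : ∀ x y, f x ≤ y ↔ k (.principal y) ≤ .principal x := fun x y => by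
    rw [← ptLE_iff, ← hk.ptLE_iff, h_principal, ptLE_iff,
      Order.PFilter.principal_le_principal_iff]
  let f' : FrameHom L M :=
    { toFun := f
      map_inf' := fun x y => ext_mem fun 𝔤 => by
        rw [← hf, Order.PFilter.inf_mem_iff, Order.PFilter.inf_mem_iff, hf, hf]
      map_top' := ext_mem fun 𝔤 => by simp [← hf]
      map_sSup' := fun s => eq_of_forall_ge_iff fun y => by
        rw [h_le, sSup_le_iff, Set.forall_mem_image]
        simp only [h_le]
        exact ⟨fun H x hx z hz => (le_sSup hx).trans (H hz),
          fun H z hz => sSup_le fun x hx => H hx hz⟩ }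
  have hgf : g = comap f' := by
    ext1 𝔤
    exact Order.PFilter.ext _ _ (Set.ext fun x => hf x 𝔤)
  exact ⟨f', (adj_comap_map f').right_unique (hgf ▸ hg)⟩

end Full

/-! ### The equivalence of categories and its inverse. -/

/-- The filter space functor from frames to completely distributive T0 spaces. -/
def filterSpaceFunctor : Frm.{u} ⥤ CDTop.{u} where
  obj L := ⟨FilterSpace L, FilterSpace.completelyDistributive⟩
  map f := ⟨FilterSpace.map f.hom, ⟨_, FilterSpace.adj_map_mapRight f.hom⟩,
    ⟨_, FilterSpace.adj_comap_map f.hom⟩⟩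
  map_id _ := CDTop.Hom.ext (ContinuousMap.ext FilterSpace.map_id_apply)
  map_comp f g := CDTop.Hom.ext (ContinuousMap.ext (FilterSpace.map_comp_apply f.hom g.hom))

/-- A homeomorphism is an isomorphism of completely distributive spaces. -/
def isoOfHomeomorph {X Y : CDTop.{u}} (e : X.carrier ≃ₜ Y.carrier) : X ≅ Y where
  hom := ⟨e, ⟨_, adj_homeomorph e⟩, ⟨_, adj_homeomorph e.symm⟩⟩
  inv := ⟨e.symm, ⟨_, adj_homeomorph e.symm⟩, ⟨_, adj_homeomorph e⟩⟩
  hom_inv_id := CDTop.Hom.ext (ContinuousMap.ext e.symm_apply_apply)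
  inv_hom_id := CDTop.Hom.ext (ContinuousMap.ext e.apply_symm_apply)

instance : filterSpaceFunctor.{u}.Faithful where
  map_injective {L M f g} h := by
    refine Frm.ext fun x => ?_
    have h' : FilterSpace.map f.hom = FilterSpace.map g.hom := congrArg CDTop.Hom.map h
    have hx := congrArg (fun k : C(_, _) => k (.principal x)) h'
    simp only [FilterSpace.map_principal] at hx
    exact le_antisymm (Order.PFilter.principal_le_principal_iff.1 hx.ge)
      (Order.PFilter.principal_le_principal_iff.1 hx.le)

instance : filterSpaceFunctor.{u}.Full where
  map_surjective h := by
    obtain ⟨f, hf⟩ := FilterSpace.exists_map_eq h.map h.isLeftAdj h.isRightAdj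
    exact ⟨Frm.ofHom f, CDTop.Hom.ext hf⟩

instance : filterSpaceFunctor.{u}.EssSurj where
  mem_essImage X := by
    obtain ⟨S, hS, t, ht⟩ := completelyDistributive_iff.1 X.cd
    exact ⟨Frm.of (SupFrame hS ht), ⟨(isoOfHomeomorph (homeomorphFilterSpace hS ht)).symm⟩⟩

instance : filterSpaceFunctor.{u}.IsEquivalence where

/-- The points of the filter space of a frame recover the underlying ordered set of the frame. -/
noncomputable def filterSpaceFunctorCompPt : filterSpaceFunctor.{u} ⋙ ptFunctor ≅
    forget₂ Frm.{u} Lat.{u} ⋙ forget₂ Lat.{u} PartOrd.{u} :=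
  (NatIso.ofComponents (F := forget₂ Frm.{u} Lat.{u} ⋙ forget₂ Lat.{u} PartOrd.{u})
      (G := filterSpaceFunctor ⋙ ptFunctor)
      (fun L : Frm.{u} => PartOrd.Iso.mk (Lam.orderIsoElement L.carrier)) fun {L M} f => by
    ext x
    refine congrArg OrderDual.toDual (Lam.ext_holds fun 𝔤 => ?_)
    have h : CDTop.leftAdj (filterSpaceFunctor.map f) = FilterSpace.comap f.hom :=
      (CDTop.adj_leftAdj _).left_unique (FilterSpace.adj_comap_map f.hom)
    -- The left adjoint used by `ptFunctor` is a chosen one, equal to `comap` only by uniqueness; a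
    -- variable `g` allows that equality to be substituted.
    have key : ∀ (y : L.carrier) (g : C(FilterSpace M.carrier, FilterSpace L.carrier)),
        g = FilterSpace.comap f.hom → ∀ 𝔥 : FilterSpace M.carrier,
          (Lam.ofElement (f.hom y)).Holds 𝔥 ↔ (Lam.ofElement y).Holds (g 𝔥) := by
      rintro y _ rfl 𝔥
      exact Iff.rfl
    exact key x _ h 𝔤).symm

end CDSpace

theorem mainTheorem5 :
    ∃ e : Frm.{u} ≌ CDTop.{u},
      Nonempty (e.functor ⋙ CDTop.toTopCat ≅ CDSpace.filterFunctor) ∧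
      Nonempty (e.inverse ⋙ (forget₂ Frm.{u} Lat.{u} ⋙ forget₂ Lat.{u} PartOrd.{u}) ≅
        CDSpace.ptFunctor) ∧
      ∀ (L M : Frm.{u}) (f g : L ⟶ M),
        (∀ x : L, f x ≤ g x) ↔
          ∀ p : (e.functor.obj L).carrier,
            CDSpace.ptLE (CDTop.contMap (e.functor.map f) p)
              (CDTop.contMap (e.functor.map g) p) := by
  let e := filterSpaceFunctor.{u}.asEquivalence
  refine ⟨e, ⟨Iso.refl filterFunctor⟩, ⟨?_⟩, fun L M f g => FilterSpace.map_le_map_iff f.hom g.hom⟩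
  -- The forgetful functor is replaced by `Pt` after `F`; the counit then cancels `F` against the
  -- inverse.
  exact Functor.isoWhiskerLeft e.inverse filterSpaceFunctorCompPt.symm ≪≫
    (Functor.associator _ _ _).symm ≪≫ Functor.isoWhiskerRight e.counitIso ptFunctor ≪≫
    ptFunctor.leftUnitor
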